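/- For integers $N\ge 1$ and $k\ge 0$ let $s(N,k)$ denote the unsigned Stirling number of the first kind, i.e. the number of permutations of $N$ elements with exactly $k$ disjoint cycles, and let $v_3$ denote the $3$-adic valuation, with $v_3(0)=\infty$. Let $n$ and $k$ be positive integers with $k\le 3^n$. Then $v_3(s(3^n,k))$ is finite, and $$ v_3(s(3^n,k))\le \begin{cases} v_3(s(3^n,1))=\tfrac12\,(3^n-2n-1), & \text{if } n\ge 3,\\ v_3(s(3^2,6))=4, & \text{if } n=2,\\ v_3(s(3,2))=1, & \text{if } n=1. \end{cases} $$ -/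

import Mathlib

open Polynomial

/-! The numbers s(3^n, k) are the coefficients of x(x+1)⋯(x+3^n-1). Write n = m + d with m = a + 1
and 3^a ≤ k ≤ 3^m, and substitute 3^d x: a power 3^E splits off, with E = (3^n - 3^m)/2, leaving F ≡
±(x^3 - x)^(3^a) mod 3^m (`exists_ascPochhammer_comp_eq`, `three_pow_dvd_ascPochhammer_sub`).

For odd k the coefficient of F is, mod 3^m, a signed binomial coefficient of 3^a, so its valuation
is at most a. For even k this says nothing; instead F = xG with G(-x-3^m) = G(x), which expresses
each even-index coefficient of F through the next odd one, up to a small error, and bounds its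
valuation by 3a + 1.

Hence v_3(s(3^n, k)) ≤ E + B - dk with B = a or 3a + 1. For k = 1 this is an equality, and for n ≥ 3
no other k exceeds it. -/

theorem coeff_ascPochhammer_int (N k : ℕ) :
    (ascPochhammer ℤ N).coeff k = (Nat.stirlingFirst N k : ℤ) := by
  induction N generalizing k with
  | zero => cases k <;> simp [Nat.stirlingFirst, coeff_one]
  | succ N ih =>
    rw [ascPochhammer_succ_right, mul_add, coeff_add, ← C_eq_natCast, coeff_mul_C, ih]
    cases k with
    | zero =>
      cases N <;> simp [Nat.stirlingFirst]
    | succ k => rw [coeff_mul_X, ih, Nat.stirlingFirst_succ_succ]; push_cast; ring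

/-! ### Tripling the length of the rising factorial, and congruences -/

/-- The product of a polynomial with its translates by `c` and `2 * c`. -/
noncomputable def tripleShift (c : ℤ) (P : ℤ[X]) : ℤ[X] :=
  P * P.comp (X + C c) * P.comp (X + C (2 * c))

theorem tripleShift_mul (c : ℤ) (P Q : ℤ[X]) :
    tripleShift c (P * Q) = tripleShift c P * tripleShift c Q := by
  simp only [tripleShift, mul_comp]; ring

theorem tripleShift_C (c a : ℤ) : tripleShift c (C a) = C (a ^ 3) := by
  simp only [tripleShift, C_comp, C_pow]; ring

theorem tripleShift_comp (c : ℤ) (P : ℤ[X]) :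
    (tripleShift (3 * c) P).comp (C 3 * X) = tripleShift c (P.comp (C 3 * X)) := by
  have h (e : ℤ) : C 3 * X + C (3 * e) = C 3 * (X + C e) := by rw [C_mul]; ring
  simp only [tripleShift, mul_comp, comp_assoc, add_comp, X_comp, C_comp, ← h]
  ring_nf

theorem ascPochhammer_three_pow_succ (n : ℕ) :
    ascPochhammer ℤ (3 ^ (n + 1)) = tripleShift (3 ^ n) (ascPochhammer ℤ (3 ^ n)) := by
  have h : 3 ^ (n + 1) = 3 ^ n + 3 ^ n + 3 ^ n := by ring
  rw [h, ← ascPochhammer_mul, ← ascPochhammer_mul, tripleShift]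
  simp [two_mul]

theorem exists_comp_X_add_C_eq (P : ℤ[X]) (c : ℤ) :
    ∃ K : ℤ[X], P.comp (X + C c) = P + derivative P * C c + K * C c ^ 2 := by
  obtain ⟨K, hK⟩ := binomExpansion (P.map C) X (C c)
  refine ⟨K, ?_⟩
  simpa [derivative_map, eval_map, comp] using hK

/-- Cubing gains one factor of 3 in a congruence, and the shifts do not spoil this. -/
theorem three_pow_dvd_tripleShift_sub {n : ℕ} (hn : n ≠ 0) {P A : ℤ[X]}
    (h : (3 : ℤ[X]) ^ n ∣ P - A) : (3 : ℤ[X]) ^ (n + 1) ∣ tripleShift (3 ^ n) P - A ^ 3 := by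
  obtain ⟨B, hB⟩ := h
  obtain rfl : P = A + 3 ^ n * B := by rw [← hB]; ring
  generalize hP : A + 3 ^ n * B = P
  obtain ⟨K₁, h₁⟩ := exists_comp_X_add_C_eq P (3 ^ n)
  obtain ⟨K₂, h₂⟩ := exists_comp_X_add_C_eq P (2 * 3 ^ n)
  have hc : (C (3 ^ n) : ℤ[X]) = 3 ^ n := by simp
  have hc2 : (C (2 * 3 ^ n) : ℤ[X]) = 2 * 3 ^ n := by simp
  rw [hc] at h₁
  rw [hc2] at h₂
  obtain ⟨m, rfl⟩ := Nat.exists_eq_succ_of_ne_zero hn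
  have h1 : (3 : ℤ[X]) ^ (m.succ + 1) ∣ tripleShift (3 ^ m.succ) P - P ^ 3 := by
    rw [tripleShift, hc, hc2, h₁, h₂]
    generalize derivative P = D
    -- The first-order terms add up to (1 + 2) * 3^n * P^2 * D; all others carry 3^(2n), and 2n ≥ n
    -- + 1.
    refine ⟨P ^ 2 * D + 3 ^ m * (P * (P * (K₁ + 4 * K₂)
      + (D + K₁ * 3 ^ m.succ) * (2 * D + 4 * K₂ * 3 ^ m.succ))), ?_⟩
    simp only [Nat.succ_eq_add_one, pow_succ]
    ring
  have h2 : (3 : ℤ[X]) ^ (m.succ + 1) ∣ P ^ 3 - A ^ 3 := by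
    rw [← hP]
    refine ⟨A ^ 2 * B + 3 ^ m.succ * A * B ^ 2 + 3 ^ m * 3 ^ m.succ * B ^ 3, ?_⟩
    simp only [Nat.succ_eq_add_one, pow_succ]
    ring
  simpa using dvd_add h1 h2

theorem three_pow_dvd_ascPochhammer_sub (a : ℕ) :
    (3 : ℤ[X]) ^ (a + 1) ∣ ascPochhammer ℤ (3 ^ (a + 1)) - (X ^ 3 - X) ^ 3 ^ a := by
  induction a with
  | zero =>
    refine ⟨X ^ 2 + X, ?_⟩
    simp [ascPochhammer_succ_right]
    ring
  | succ a ih =>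
    rw [ascPochhammer_three_pow_succ,
      show ((X : ℤ[X]) ^ 3 - X) ^ 3 ^ (a + 1) = ((X ^ 3 - X) ^ 3 ^ a) ^ 3 by rw [pow_succ 3, pow_mul]]
    exact three_pow_dvd_tripleShift_sub a.succ_ne_zero ih

/-- The product of the factors of `ascPochhammer ℤ (3 ^ (n + 1))` with constant term prime to `3`,
evaluated at `3 * X`. -/
noncomputable def unitFactor : ℕ → ℤ[X]
  | 0 => (C 3 * X + 1) * (C 3 * X + 2)
  | n + 1 => tripleShift (3 ^ n) (unitFactor n)

/-- The 3^n factors 3X + j with 3 ∣ j each give up a 3 and form the shorter rising factorial. -/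
theorem ascPochhammer_comp_three_mul (n : ℕ) :
    (ascPochhammer ℤ (3 ^ (n + 1))).comp (C 3 * X) =
      C (3 ^ 3 ^ n) * unitFactor n * ascPochhammer ℤ (3 ^ n) := by
  induction n with
  | zero => simp [ascPochhammer_succ_right, unitFactor]; ring
  | succ n ih =>
    rw [ascPochhammer_three_pow_succ (n + 1), pow_succ' (3 : ℤ) n, tripleShift_comp, ih,
      tripleShift_mul, tripleShift_mul, tripleShift_C, ← ascPochhammer_three_pow_succ, unitFactor,
      ← pow_mul, ← pow_succ]

/-- A polynomial form of Wilson's theorem for the units modulo a power of 3. -/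
theorem three_pow_dvd_unitFactor_add_one (n : ℕ) : (3 : ℤ[X]) ^ n ∣ unitFactor n + 1 := by
  induction n with
  | zero => simp
  | succ n ih =>
    rcases n.eq_zero_or_pos with rfl | hn
    · obtain ⟨U, hU⟩ : ∃ U : ℤ[X], unitFactor 0 = 3 * U - 1 :=
        ⟨3 * X ^ 2 + 3 * X + 1, by simp only [unitFactor, map_ofNat]; ring⟩
      rw [unitFactor, hU]
      simp only [tripleShift, sub_comp, mul_comp, ofNat_comp, one_comp]
      generalize U.comp (X + C (3 ^ 0)) = V
      generalize U.comp (X + C (2 * 3 ^ 0)) = W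
      exact ⟨9 * U * V * W - 3 * (U * V + V * W + U * W) + U + V + W, by ring⟩
    · have := three_pow_dvd_tripleShift_sub hn.ne' (P := unitFactor n) (A := -1) (by simpa using ih)
      rw [unitFactor]
      convert this using 1
      ring

/-! ### Reflection symmetry and rescaling -/

theorem ascPochhammer_succ_comp_neg (N : ℕ) :
    (ascPochhammer ℤ (N + 1)).comp (-X - (N : ℤ[X])) = (-1) ^ (N + 1) * ascPochhammer ℤ (N + 1) := by
  induction N with
  | zero => simp
  | succ N ih =>
    have h : -X - ((N + 1 : ℕ) : ℤ[X]) = (-X - (N : ℤ[X])).comp (X + 1) := by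
      simp; ring
    conv_rhs => rw [ascPochhammer_succ_left]
    rw [ascPochhammer_succ_right, mul_comp, h, ← comp_assoc, ih]
    simp only [mul_comp, pow_comp, neg_comp, one_comp, add_comp, sub_comp, X_comp, natCast_comp,
      Nat.cast_add, Nat.cast_one]
    ring

theorem X_mul_ascPochhammer_comp_neg {N : ℕ} (hN : Odd N) :
    X * (ascPochhammer ℤ N).comp (-X - (N : ℤ[X])) = -(X + (N : ℤ[X])) * ascPochhammer ℤ N := by
  have h := ascPochhammer_succ_comp_neg N
  rw [ascPochhammer_succ_right, mul_comp, hN.add_one.neg_one_pow] at h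
  simp at h
  linear_combination -h

theorem exists_ascPochhammer_comp_eq (m d : ℕ) :
    ∃ (E : ℕ) (F : ℤ[X]), 2 * E + 3 ^ m = 3 ^ (m + d) ∧
      (ascPochhammer ℤ (3 ^ (m + d))).comp (C (3 ^ d) * X) = C (3 ^ E) * F ∧
      (3 : ℤ[X]) ^ m ∣ F - (-1) ^ d * ascPochhammer ℤ (3 ^ m) := by
  induction d with
  | zero => exact ⟨0, ascPochhammer ℤ (3 ^ m), by simp⟩
  | succ d ih =>
    obtain ⟨E, F, hE, hF, hd⟩ := ih
    refine ⟨E + 3 ^ (m + d), (unitFactor (m + d)).comp (C (3 ^ d) * X) * F, ?_, ?_, ?_⟩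
    · rw [← add_assoc m, pow_succ, ← hE]; ring
    · have h : (C (3 ^ (d + 1)) * X : ℤ[X]) = (C 3 * X : ℤ[X]).comp (C (3 ^ d) * X) := by
        simp; ring
      rw [h, ← comp_assoc, ← add_assoc m, ascPochhammer_comp_three_mul, mul_comp, mul_comp, hF,
        C_comp, pow_add (3 : ℤ) E, C_mul]
      ring
    · have h : (3 : ℤ[X]) ^ m ∣ (unitFactor (m + d)).comp (C (3 ^ d) * X) + 1 := by
        obtain ⟨Q, hQ⟩ := three_pow_dvd_unitFactor_add_one (m + d)
        refine ⟨3 ^ d * Q.comp (C (3 ^ d) * X), ?_⟩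
        have := congrArg (fun P : ℤ[X] => P.comp (C (3 ^ d) * X)) hQ
        simp only [add_comp, mul_comp, one_comp, pow_comp, ofNat_comp] at this
        rw [this]
        ring
      generalize (unitFactor (m + d)).comp (C (3 ^ d) * X) = u at *
      have := dvd_sub (h.mul_right F) hd
      convert this using 1
      ring

/-- Without the root 0, the roots -1, …, -(N-1) are permuted by x ↦ -x - N, and for odd N their
number is even, so no sign appears. Scaling by 3^d turns N = 3^(m+d) into 3^m. -/
theorem exists_reflection_symmetric {m d E : ℕ} {F : ℤ[X]}
    (hF : (ascPochhammer ℤ (3 ^ (m + d))).comp (C (3 ^ d) * X) = C (3 ^ E) * F) :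
    ∃ G : ℤ[X], F = X * G ∧ G.comp (-X - C (3 ^ m)) = G := by
  have hE : (C (3 ^ E) : ℤ[X]) ≠ 0 := by simp
  have h3d : (3 ^ d : ℤ[X]) ≠ 0 := by simp
  have h0 : X ∣ F := by
    have := congrArg (eval 0) hF
    rw [X_dvd_iff, coeff_zero_eq_eval_zero]
    simpa [eval_comp, ascPochhammer_eval_zero] using this.symm
  obtain ⟨G, rfl⟩ := h0
  refine ⟨G, rfl, ?_⟩
  have hodd : Odd (3 ^ (m + d)) := Odd.pow (by decide)
  have h := congrArg (fun P : ℤ[X] => P.comp (C (3 ^ d) * X)) (X_mul_ascPochhammer_comp_neg hodd)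
  have e : (-X - ((3 ^ (m + d) : ℕ) : ℤ[X])).comp (C (3 ^ d) * X)
      = (C (3 ^ d) * X : ℤ[X]).comp (-X - C (3 ^ m)) := by
    simp; ring
  simp only [mul_comp, comp_assoc] at h
  rw [e, ← comp_assoc, hF] at h
  have hX : (X + C (3 ^ m) : ℤ[X]) ≠ 0 := X_add_C_ne_zero _
  simp only [mul_comp, C_comp, X_comp, neg_comp, add_comp, natCast_comp] at h
  refine mul_left_cancel₀ (mul_ne_zero (mul_ne_zero (mul_ne_zero hE h3d) hX) X_ne_zero) ?_
  have hd : (C (3 ^ d) : ℤ[X]) = 3 ^ d := by simp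
  have hm : (C (3 ^ m) : ℤ[X]) = 3 ^ m := by simp
  rw [hm] at h ⊢
  rw [hd] at h
  push_cast at h
  rw [pow_add (3 : ℤ[X]) m d] at h
  linear_combination -h

/-! ### Coefficients of odd index -/

theorem three_pow_dvd_coeff {n : ℕ} {P : ℤ[X]} (h : (3 : ℤ[X]) ^ n ∣ P) (k : ℕ) :
    (3 : ℤ) ^ n ∣ P.coeff k := by
  have h' : C ((3 : ℤ) ^ n) ∣ P := by simpa using h
  exact (C_dvd_iff_dvd_coeff _ _).1 h' k

theorem not_three_pow_dvd_choose {a i : ℕ} (hi : i ≤ 3 ^ a) :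
    ¬ 3 ^ (a + 1) ∣ (3 ^ a).choose i := by
  intro h
  rcases Nat.eq_zero_or_pos i with rfl | h0
  · simp at h
  have h1 := Nat.factorization_choose_prime_pow Nat.prime_three hi h0.ne'
  have h2 := (Nat.prime_three.pow_dvd_iff_le_factorization (Nat.choose_pos hi).ne').1 h
  omega

theorem coeff_X_pow_three_sub_X_pow (N i : ℕ) :
    ((X ^ 3 - X : ℤ[X]) ^ N).coeff (N + 2 * i) = (-1) ^ (N - i) * (N.choose i : ℤ) := by
  have h : (X ^ 3 - X : ℤ[X]) ^ N = X ^ N * expand ℤ 2 ((X + C (-1)) ^ N) := by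
    simp [← mul_pow]; ring
  rw [h, coeff_X_pow_mul', if_pos (by omega), Nat.add_sub_cancel_left, mul_comm 2 i,
    coeff_expand_mul two_pos, coeff_X_add_C_pow]

theorem not_three_pow_dvd_coeff_of_odd {a k : ℕ} (hk : Odd k) (h1 : 3 ^ a ≤ k)
    (h2 : k ≤ 3 ^ (a + 1)) {F : ℤ[X]} {d : ℕ}
    (hF : (3 : ℤ[X]) ^ (a + 1) ∣ F - (-1) ^ d * ascPochhammer ℤ (3 ^ (a + 1))) :
    ¬ (3 : ℤ) ^ (a + 1) ∣ F.coeff k := by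
  intro h
  have h3 : Odd (3 ^ a) := Odd.pow (by decide)
  obtain ⟨i, rfl⟩ : ∃ i, k = 3 ^ a + 2 * i :=
    ⟨(k - 3 ^ a) / 2, by obtain ⟨x, hx⟩ := hk; obtain ⟨y, hy⟩ := h3; omega⟩
  have hi : i ≤ 3 ^ a := by rw [pow_succ] at h2; omega
  have hd : (3 : ℤ[X]) ^ (a + 1) ∣ F - (-1) ^ d * (X ^ 3 - X) ^ 3 ^ a := by
    convert dvd_add hF ((three_pow_dvd_ascPochhammer_sub a).mul_left ((-1) ^ d)) using 1
    ring
  have hc := three_pow_dvd_coeff hd (3 ^ a + 2 * i)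
  have hs : ((-1) ^ d * (X ^ 3 - X) ^ 3 ^ a : ℤ[X]) = C ((-1) ^ d) * (X ^ 3 - X) ^ 3 ^ a := by simp
  rw [coeff_sub, hs, coeff_C_mul, coeff_X_pow_three_sub_X_pow, dvd_sub_right h] at hc
  rcases neg_one_pow_eq_or ℤ d with e | e <;>
    rcases neg_one_pow_eq_or ℤ (3 ^ a - i) with e' | e' <;>
    · rw [e, e'] at hc
      simp only [one_mul, neg_mul, neg_neg, dvd_neg] at hc
      exact not_three_pow_dvd_choose hi (by exact_mod_cast hc)

/-! ### Coefficients of even index -/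

theorem succ_lt_three_pow_succ (l : ℕ) : l + 1 < 3 ^ (l + 1) := Nat.lt_pow_self (by norm_num)

theorem isCoprime_three_pow_of_not_dvd {u : ℕ} (hu : ¬ 3 ∣ u) (e : ℕ) :
    IsCoprime ((3 : ℤ) ^ e) u := by
  exact_mod_cast Nat.isCoprime_iff_coprime.2
    (((Nat.Prime.coprime_iff_not_dvd Nat.prime_three).2 hu).pow_left e)

/-- The valuation of l + 2 is at most l, since l + 2 < 3^(l+1). -/
theorem three_pow_dvd_three_pow_mul_of_dvd_mul {e l : ℕ} {p : ℤ}
    (h : (3 : ℤ) ^ e ∣ ((l + 2 : ℕ) : ℤ) * p) : (3 : ℤ) ^ e ∣ 3 ^ l * p := by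
  obtain ⟨v, u, hu, hl⟩ := Nat.exists_eq_pow_mul_and_not_dvd (n := l + 2) (by omega) 3 (by norm_num)
  have hv : v ≤ l := by
    by_contra hv
    have h1 : 3 ^ (l + 1) ≤ 3 ^ v := Nat.pow_le_pow_right (by norm_num) (by omega)
    have h2 : 0 < u := Nat.pos_of_ne_zero (by rintro rfl; simp at hu)
    have h3 : 3 ^ v ≤ l + 2 := by rw [hl]; exact Nat.le_mul_of_pos_right _ h2
    have h4 : l + 2 < 3 ^ (l + 1) := by
      rcases l with _ | l
      · norm_num
      · have := succ_lt_three_pow_succ l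
        rw [pow_succ]; omega
    omega
  rw [hl] at h
  push_cast at h
  rw [mul_comm ((3 : ℤ) ^ v), mul_assoc] at h
  have hc := isCoprime_three_pow_of_not_dvd hu e
  have := hc.dvd_of_dvd_mul_left h
  refine this.trans (mul_dvd_mul_right (pow_dvd_pow _ hv) _)

/-- By symmetry G(x - 3^m) = G(-x). Comparing coefficients of x^i for odd i gives -g_i = g_i - (i+1)
3^m g_(i+1) + ⋯, and the tail is divisible by 3^(v+2m). -/
theorem three_pow_dvd_two_mul_coeff_sub {m i v : ℕ} (hm : m ≠ 0) {G : ℤ[X]}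
    (hG : G.comp (-X - C (3 ^ m)) = G) (hi : Odd i) (hv : 3 ^ v ∣ i + 1) :
    (3 : ℤ) ^ (v + 2 * m) ∣ 2 * G.coeff i - ((i + 1 : ℕ) : ℤ) * 3 ^ m * G.coeff (i + 1) := by
  have h1 : (hasseDeriv i G).eval (-(3 ^ m : ℤ)) = - G.coeff i := by
    have h2 : taylor (-(3 ^ m : ℤ)) G = G.comp (-X) := by
      conv_rhs => rw [← hG]
      rw [comp_assoc, taylor_apply]
      congr 1
      simp
      ring
    rw [← taylor_coeff, h2, show (-X : ℤ[X]) = C (-1) * X by simp, comp_C_mul_X_coeff, hi.neg_one_pow]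
    simp
  set P := hasseDeriv i G with hP
  have hc (l : ℕ) : P.coeff l = ((l + i).choose i : ℤ) * G.coeff (l + i) := by
    rw [hP, hasseDeriv_coeff]
  rw [eval_eq_sum_range' (n := P.natDegree + 2) (by omega), Finset.sum_range_succ',
    Finset.sum_range_succ'] at h1
  have h3 : (3 : ℤ) ^ (v + 2 * m) ∣
      ∑ l ∈ Finset.range P.natDegree, P.coeff (l + 1 + 1) * (-3 ^ m) ^ (l + 1 + 1) := by
    refine Finset.dvd_sum fun l _ => ?_
    have h4 : (3 : ℤ) ^ v ∣ ((l + 2 : ℕ) : ℤ) * P.coeff (l + 2) := by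
      -- The binomial coefficient inherits 3^v from i + 1 up to the factor l + 2, which the spare
      -- 3^l in 3^(m(l+2)) absorbs.
      have h5 : (l + 2) * (l + 2 + i).choose i = (i + 1) * (l + 2 + i).choose (i + 1) := by
        have := Nat.choose_succ_right_eq (l + 2 + i) i
        rw [Nat.add_sub_cancel] at this
        linarith
      rw [hc, ← mul_assoc]
      apply Dvd.dvd.mul_right
      exact_mod_cast h5 ▸ Dvd.dvd.mul_right hv _
    have h6 := three_pow_dvd_three_pow_mul_of_dvd_mul h4
    have h7 : P.coeff (l + 1 + 1) * (-3 ^ m : ℤ) ^ (l + 1 + 1)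
        = (3 ^ l * P.coeff (l + 2)) * 3 ^ (2 * m) * ((-1) ^ l * 3 ^ ((m - 1) * l)) := by
      obtain ⟨m, rfl⟩ := Nat.exists_eq_succ_of_ne_zero hm
      rw [neg_pow]
      simp only [Nat.succ_eq_add_one, Nat.add_sub_cancel]
      ring
    rw [h7, pow_add]
    exact (mul_dvd_mul_right h6 _).mul_right _
  rw [hc 0, hc] at h1
  have h8 : 2 * G.coeff i - ((i + 1 : ℕ) : ℤ) * 3 ^ m * G.coeff (i + 1) = -
      ∑ l ∈ Finset.range P.natDegree, P.coeff (l + 1 + 1) * (-3 ^ m) ^ (l + 1 + 1) := by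
    have : (0 + 1 + i).choose i = i + 1 := by simp [add_comm]
    rw [this, show 0 + 1 + i = i + 1 by ring] at h1
    simp at h1
    push_cast
    linear_combination h1
  rw [h8]
  exact h3.neg_right

/-- The valuation of g_i is that of (i+1) 3^m g_(i+1), hence at most (m-1) + m + (m-1) = 3m - 2. -/
theorem not_three_pow_dvd_coeff_of_odd_reflection {m i : ℕ} (hm : m ≠ 0) {G : ℤ[X]}
    (hG : G.comp (-X - C (3 ^ m)) = G) (hi : Odd i) (him : i + 1 < 3 ^ m)
    (h : ¬ (3 : ℤ) ^ m ∣ G.coeff (i + 1)) : ¬ (3 : ℤ) ^ (3 * m - 1) ∣ G.coeff i := by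
  intro hd
  obtain ⟨v, u, hu, hl⟩ := Nat.exists_eq_pow_mul_and_not_dvd (n := i + 1) (by omega) 3 (by norm_num)
  have hv : v < m := by
    rw [← Nat.pow_lt_pow_iff_right (a := 3) (by norm_num)]
    refine lt_of_le_of_lt ?_ him
    exact Nat.le_of_dvd (by omega) (hl ▸ dvd_mul_right _ _)
  have h1 := three_pow_dvd_two_mul_coeff_sub hm hG hi (hl ▸ dvd_mul_right _ _)
  have h2 : (3 : ℤ) ^ (v + 2 * m) ∣ 2 * G.coeff i :=
    ((pow_dvd_pow _ (by omega)).trans hd).mul_left _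
  rw [dvd_sub_right h2] at h1
  have h3 : ((i + 1 : ℕ) : ℤ) * 3 ^ m * G.coeff (i + 1)
      = 3 ^ (v + m) * (u * G.coeff (i + 1)) := by
    rw [show ((i + 1 : ℕ) : ℤ) = 3 ^ v * u by exact_mod_cast hl]; ring
  rw [h3, show v + 2 * m = v + m + m by ring, pow_add (3 : ℤ) (v + m)] at h1
  have h4 := (mul_dvd_mul_iff_left (by positivity)).1 h1
  have hc := isCoprime_three_pow_of_not_dvd hu m
  exact h (hc.dvd_of_dvd_mul_left h4)

/-! ### Valuation bounds and comparison with k = 1 -/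

theorem exists_three_pow_le_le {n k : ℕ} (hn : 1 ≤ n) (hk : 1 ≤ k) (hkn : k ≤ 3 ^ n) :
    ∃ a d, n = a + 1 + d ∧ 3 ^ a ≤ k ∧ k ≤ 3 ^ (a + 1) := by
  induction n, hn using Nat.le_induction with
  | base => exact ⟨0, 0, by simp_all⟩
  | succ n hn ih =>
    by_cases h : k ≤ 3 ^ n
    · obtain ⟨a, d, h1, h2⟩ := ih h
      exact ⟨a, d + 1, by omega, h2⟩
    · exact ⟨n, 0, rfl, by omega, hkn⟩

/-- The coefficients of `ascPochhammer ℤ (3 ^ (a + 1 + d))` in the range `[3 ^ a, 3 ^ (a + 1)]`,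
after removal of the power of `3` that comes from the Newton polygon. -/
theorem exists_pow_mul_stirlingFirst_eq (a d : ℕ) :
    ∃ (E : ℕ) (b : ℕ → ℤ), 2 * E + 3 ^ (a + 1) = 3 ^ (a + 1 + d) ∧
      (∀ k, (3 : ℤ) ^ (d * k) * Nat.stirlingFirst (3 ^ (a + 1 + d)) k = 3 ^ E * b k) ∧
      (∀ k, 3 ^ a ≤ k → k ≤ 3 ^ (a + 1) → Odd k → ¬ (3 : ℤ) ^ (a + 1) ∣ b k) ∧
      (∀ k, 3 ^ a ≤ k → k ≤ 3 ^ (a + 1) → Even k → ¬ (3 : ℤ) ^ (3 * a + 2) ∣ b k) := by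
  obtain ⟨E, F, hE, hF, hd⟩ := exists_ascPochhammer_comp_eq (a + 1) d
  have hodd (k) (h1 : 3 ^ a ≤ k) (h2 : k ≤ 3 ^ (a + 1)) (hk : Odd k) :=
    not_three_pow_dvd_coeff_of_odd hk h1 h2 hd
  refine ⟨E, F.coeff, hE, fun k => ?_, hodd, fun k h1 h2 hk => ?_⟩
  · have := congrArg (coeff · k) hF
    simp only [coeff_C_mul, comp_C_mul_X_coeff, coeff_ascPochhammer_int] at this
    rw [← this, pow_mul, mul_comm]
  · obtain ⟨G, rfl, hG⟩ := exists_reflection_symmetric hF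
    have h0 : 0 < 3 ^ a := by positivity
    obtain ⟨i, rfl⟩ : ∃ i, k = i + 1 := ⟨k - 1, by omega⟩
    -- An even k is not the right endpoint, so k + 1 is still in the range of the odd case.
    have hne : i + 1 ≠ 3 ^ (a + 1) := by
      intro h
      rw [h] at hk
      exact Nat.not_even_iff_odd.2 (Odd.pow (by decide)) hk
    have h3 := hodd (i + 1 + 1) (by omega) (by omega) hk.add_one
    rw [coeff_X_mul] at h3 ⊢
    exact not_three_pow_dvd_coeff_of_odd_reflection a.succ_ne_zero hG
      (by rcases Nat.even_or_odd i with h | h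
          · exact absurd hk (Nat.not_even_iff_odd.2 h.add_one)
          · exact h) (by omega) h3

theorem ne_zero_and_add_padicValNat_le {s u E B : ℕ} {b : ℤ} (h : (3 : ℤ) ^ u * s = 3 ^ E * b)
    (hb : ¬ (3 : ℤ) ^ (B + 1) ∣ b) : s ≠ 0 ∧ u + padicValNat 3 s ≤ E + B := by
  have hs : s ≠ 0 := by
    rintro rfl
    simp only [Nat.cast_zero, mul_zero, zero_eq_mul, pow_eq_zero_iff', OfNat.ofNat_ne_zero,
      false_and, false_or] at h
    simp [h] at hb
  refine ⟨hs, ?_⟩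
  by_contra! hlt
  apply hb
  have h1 : (3 : ℤ) ^ padicValNat 3 s ∣ s := by exact_mod_cast pow_padicValNat_dvd
  have h2 : (3 : ℤ) ^ (E + (B + 1)) ∣ 3 ^ E * b := by
    rw [← h]
    refine (pow_dvd_pow _ (by omega : _ ≤ u + padicValNat 3 s)).trans ?_
    rw [pow_add]
    exact mul_dvd_mul_left _ h1
  rw [pow_add] at h2
  exact (mul_dvd_mul_iff_left (by positivity)).1 h2

theorem two_mul_padicValNat_stirlingFirst_one {n : ℕ} (hn : 1 ≤ n) :
    2 * padicValNat 3 (Nat.stirlingFirst (3 ^ n) 1) + 2 * n + 1 = 3 ^ n := by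
  obtain ⟨d, rfl⟩ := Nat.exists_eq_add_of_le hn
  obtain ⟨E, b, hE, hs, ho, -⟩ := exists_pow_mul_stirlingFirst_eq 0 d
  simp only [zero_add] at *
  have h1 := ho 1 (by norm_num) (by norm_num) odd_one
  obtain ⟨h0, h2⟩ := ne_zero_and_add_padicValNat_le (hs 1) (B := 0) h1
  have h3 : E ≤ d * 1 + padicValNat 3 (Nat.stirlingFirst (3 ^ (1 + d)) 1) := by
    have h4 : 3 ^ E ∣ 3 ^ (d * 1) * Nat.stirlingFirst (3 ^ (1 + d)) 1 := by
      have := Dvd.intro _ (hs 1).symm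
      exact_mod_cast this
    have h5 := (padicValNat_dvd_iff_le (p := 3) (by positivity)).1 h4
    rwa [padicValNat.mul (by positivity) h0, padicValNat.prime_pow] at h5
  omega

theorem eight_mul_add_five_le_three_pow (a : ℕ) (ha : 2 ≤ a) : 8 * a + 5 ≤ 3 ^ (a + 1) := by
  induction a, ha using Nat.le_induction with
  | base => norm_num
  | succ a _ ih => rw [pow_succ]; omega

theorem two_mul_add_one_le_three_pow (a : ℕ) : 2 * a + 1 ≤ 3 ^ a := by
  induction a with
  | zero => norm_num
  | succ a ih => rw [pow_succ]; omega

theorem stirlingFirst_ne_zero_of_le {N k : ℕ} (hk : 1 ≤ k) (hkN : k ≤ N) :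
    Nat.stirlingFirst N k ≠ 0 := by
  induction N generalizing k with
  | zero => omega
  | succ N ih =>
    obtain ⟨k, rfl⟩ := Nat.exists_eq_add_of_le' hk
    rw [Nat.stirlingFirst_succ_succ]
    rcases k.eq_zero_or_pos with rfl | h
    · rcases N.eq_zero_or_pos with rfl | hN
      · simp
      · have := ih le_rfl hN
        positivity
    · have := ih h (by omega)
      omega

theorem padicValNat_stirlingFirst_le {n k : ℕ} (hn : 3 ≤ n) (hk : 1 ≤ k) (hkn : k ≤ 3 ^ n) :
    padicValNat 3 (Nat.stirlingFirst (3 ^ n) k) ≤ padicValNat 3 (Nat.stirlingFirst (3 ^ n) 1) := by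
  have h1 := two_mul_padicValNat_stirlingFirst_one (by omega : 1 ≤ n)
  obtain ⟨a, d, rfl, h2, h3⟩ := exists_three_pow_le_le (by omega) hk hkn
  obtain ⟨E, b, hE, hs, ho, he⟩ := exists_pow_mul_stirlingFirst_eq a d
  rcases Nat.even_or_odd k with hp | hp
  · have h4 := (ne_zero_and_add_padicValNat_le (hs k) (he k h2 h3 hp)).2
    -- What is needed is 8a + 5 ≤ 3^(a+1) + 2d(k-1). It holds without the last term once a ≥ 2; for
    -- a ≤ 1 it uses d ≥ 1, which n ≥ 3 ensures. This is where n = 1 and n = 2 fail.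
    obtain rfl | rfl | ha : a = 0 ∨ a = 1 ∨ 2 ≤ a := by omega
    · obtain rfl : k = 2 := by
        obtain ⟨j, rfl⟩ := hp
        omega
      omega
    · have h5 : d * 4 ≤ d * k := Nat.mul_le_mul_left _ (by obtain ⟨j, rfl⟩ := hp; omega)
      omega
    · have h5 : d * 1 ≤ d * k := Nat.mul_le_mul_left _ hk
      have := eight_mul_add_five_le_three_pow a ha
      omega
  · have h4 := (ne_zero_and_add_padicValNat_le (hs k) (ho k h2 h3 hp)).2
    have h5 : d * 1 ≤ d * k := Nat.mul_le_mul_left _ hk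
    have h6 := two_mul_add_one_le_three_pow a
    rw [pow_succ] at hE
    omega

/-! ### The exceptional cases n = 1, 2 and the conclusion -/

theorem padicValNat_three_eq {v u : ℕ} (hu : ¬ 3 ∣ u) : padicValNat 3 (3 ^ v * u) = v := by
  rw [padicValNat.mul (by positivity) (by rintro rfl; simp at hu), padicValNat.prime_pow,
    padicValNat.eq_zero_of_not_dvd hu, add_zero]

theorem padicValNat_stirlingFirst_three_two : padicValNat 3 (Nat.stirlingFirst 3 2) = 1 :=
  padicValNat_three_eq (v := 1) (u := 1) (by norm_num)

theorem padicValNat_stirlingFirst_nine_six : padicValNat 3 (Nat.stirlingFirst 9 6) = 4 := by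
  rw [show Nat.stirlingFirst 9 6 = 3 ^ 4 * 56 by decide]
  exact padicValNat_three_eq (by norm_num)

theorem padicValNat_le_of_not_dvd {v s : ℕ} (h : ¬ 3 ^ (v + 1) ∣ s) : padicValNat 3 s ≤ v := by
  by_contra! hv
  exact h ((pow_dvd_pow _ hv).trans pow_padicValNat_dvd)

theorem theorem1p4 (n k : ℕ) (hn : 1 ≤ n) (hk : 1 ≤ k) (hkn : k ≤ 3 ^ n) :
    Nat.stirlingFirst (3 ^ n) k ≠ 0 ∧
    (3 ≤ n →
      padicValNat 3 (Nat.stirlingFirst (3 ^ n) k) ≤ padicValNat 3 (Nat.stirlingFirst (3 ^ n) 1) ∧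
      (padicValNat 3 (Nat.stirlingFirst (3 ^ n) 1) : ℚ) = ((3 : ℚ) ^ n - 2 * (n : ℚ) - 1) / 2) ∧
    (n = 2 →
      padicValNat 3 (Nat.stirlingFirst (3 ^ n) k) ≤ padicValNat 3 (Nat.stirlingFirst (3 ^ 2) 6) ∧
      padicValNat 3 (Nat.stirlingFirst (3 ^ 2) 6) = 4) ∧
    (n = 1 →
      padicValNat 3 (Nat.stirlingFirst (3 ^ n) k) ≤ padicValNat 3 (Nat.stirlingFirst 3 2) ∧
      padicValNat 3 (Nat.stirlingFirst 3 2) = 1) := by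
  refine ⟨stirlingFirst_ne_zero_of_le hk hkn,
    fun h3 => ⟨padicValNat_stirlingFirst_le h3 hk hkn, ?_⟩, ?_, ?_⟩
  · have h : (2 * padicValNat 3 (Nat.stirlingFirst (3 ^ n) 1) + 2 * n + 1 : ℚ) = 3 ^ n := by
      exact_mod_cast two_mul_padicValNat_stirlingFirst_one hn
    linarith
  · rintro rfl
    norm_num only [Nat.reducePow] at hkn ⊢
    refine ⟨?_, padicValNat_stirlingFirst_nine_six⟩
    rw [padicValNat_stirlingFirst_nine_six]
    apply padicValNat_le_of_not_dvd
    interval_cases k <;> decide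
  · rintro rfl
    norm_num only [pow_one] at hkn ⊢
    refine ⟨?_, padicValNat_stirlingFirst_three_two⟩
    rw [padicValNat_stirlingFirst_three_two]
    apply padicValNat_le_of_not_dvd
    interval_cases k <;> decide
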